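/- Let $n\ge 3$, let $\Bbbk$ be a field of characteristic zero, $S=\Bbbk[x_1,\dots,x_n]$, $d\ge 2$, and $\ell=x_1+\cdots+x_n$. For a homogeneous ideal $I\subset S$ put $R=S/I$, with graded pieces $R_j$ and Hilbert function $\mathrm{HF}(R,j)=\dim_{\Bbbk}R_j$. For a linear form $\ell'$, the map $\ell'^{\,i}:R_j\to R_{j+i}$ (multiplication by $\ell'^{\,i}$) has maximal rank if it is injective or surjective; $R$ has the strong Lefschetz property (SLP) if there is a linear form $\ell'$ such that $\ell'^{\,i}:R_j\to R_{j+i}$ has maximal rank for all $i\ge 1$ and $j\ge 0$. (i) Let $I\subset S$ be a monomial ideal generated in degree $d$ such that $R=S/I$ is artinian and fails the SLP. Then $\mathrm{HF}(R,d)\ge 4$ if $d=2$, and $\mathrm{HF}(R,d)\ge 3$ if $d\ge 3$. This is sharp: for every $d\ge 3$ and $n\ge 3$, and for $d=2$ and every $n\ge 4$, there is a monomial ideal $I\subset S$ generated in degree $d$ such that $R=S/I$ is artinian and fails the SLP, the map $\ell^{d-1}:R_1\to R_d$ is not surjective, and $\mathrm{HF}(R,d)$ equals this bound. (ii) Let $1\le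 i\le d-1$ and let $I\subset S$ be a monomial ideal generated in degree $d$ such that $R=S/I$ is artinian. If $\ell^i:R_j\to R_{j+i}$ fails to have maximal rank for some $j\ge 0$, then $\mathrm{HF}(R,d)\ge d-i+2$. This is sharp for every $2\le i\le d-1$: if $I$ is the ideal generated by all monomials $x_1^{a_1}\cdots x_n^{a_n}$ of degree $d$ for which $y_1^{a_1}\cdots y_n^{a_n}$ does not occur with non-zero coefficient in $y_1^{i-1}(y_2-y_3)^{d-i+1}$, then $R=S/I$ is artinian, the map $\ell^i:R_{d-i}\to R_d$ is not surjective and does not have maximal rank, and $\mathrm{HF}(R,d)=d-i+2$. -/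

import Mathlib

open MvPolynomial

noncomputable section

/-- `I` is a monomial ideal generated in degree `d`: it is generated by a set of monomials,
all of degree `d`. -/
def IsMonomialIdealGeneratedInDegree {n : ℕ} {𝕜 : Type*} [Field 𝕜]
    (I : Ideal (MvPolynomial (Fin n) 𝕜)) (d : ℕ) : Prop :=
  ∃ T : Set (Fin n →₀ ℕ), (∀ a ∈ T, a.degree = d) ∧
    I = Ideal.span ((fun a => (monomial a (1 : 𝕜))) '' T)

/-- The graded piece `R_j` of `R = S/I`: the image in `S/I` of the forms of degree `j`. -/
def gradedPiece {n : ℕ} {𝕜 : Type*} [Field 𝕜]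
    (I : Ideal (MvPolynomial (Fin n) 𝕜)) (j : ℕ) :
    Submodule 𝕜 (MvPolynomial (Fin n) 𝕜 ⧸ I) :=
  (homogeneousSubmodule (Fin n) 𝕜 j).map (Ideal.Quotient.mkₐ 𝕜 I).toLinearMap

/-- The Hilbert function of `R = S/I`: `HF(R, j) = dim R_j`. -/
def hilbertFn {n : ℕ} {𝕜 : Type*} [Field 𝕜]
    (I : Ideal (MvPolynomial (Fin n) 𝕜)) (j : ℕ) : ℕ :=
  Module.finrank 𝕜 (gradedPiece I j)

/-- Multiplication by `ℓ ^ i` on `R = S/I`. -/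
def mulPow {n : ℕ} {𝕜 : Type*} [Field 𝕜]
    (I : Ideal (MvPolynomial (Fin n) 𝕜)) (l : MvPolynomial (Fin n) 𝕜) (i : ℕ) :
    (MvPolynomial (Fin n) 𝕜 ⧸ I) →ₗ[𝕜] (MvPolynomial (Fin n) 𝕜 ⧸ I) :=
  LinearMap.mulLeft 𝕜 (Ideal.Quotient.mk I l ^ i)

/-- For a linear form `ℓ`, multiplication by `ℓ ^ i` maps `R_j` into `R_{j+i}`. -/
theorem mulPow_mapsTo {n : ℕ} {𝕜 : Type*} [Field 𝕜]
    (I : Ideal (MvPolynomial (Fin n) 𝕜)) {l : MvPolynomial (Fin n) 𝕜}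
    (hl : l.IsHomogeneous 1) (i j : ℕ) :
    Set.MapsTo (mulPow I l i) (gradedPiece I j) (gradedPiece I (j + i)) := by
  rintro _ ⟨f, hf, rfl⟩
  refine ⟨l ^ i * f, ?_, ?_⟩
  · have h := (hl.pow i).mul ((mem_homogeneousSubmodule j f).1 hf)
    rw [one_mul, add_comm] at h
    exact (mem_homogeneousSubmodule _ _).2 h
  · simp [mulPow]

/-- The map `ℓ ^ i : R_j → R_{j+i}` is injective. -/
def MulPowInjective {n : ℕ} {𝕜 : Type*} [Field 𝕜]
    (I : Ideal (MvPolynomial (Fin n) 𝕜)) (l : MvPolynomial (Fin n) 𝕜) (i j : ℕ) : Prop :=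
  Set.InjOn (mulPow I l i) (gradedPiece I j)

/-- The map `ℓ ^ i : R_j → R_{j+i}` is surjective. -/
def MulPowSurjective {n : ℕ} {𝕜 : Type*} [Field 𝕜]
    (I : Ideal (MvPolynomial (Fin n) 𝕜)) (l : MvPolynomial (Fin n) 𝕜) (i j : ℕ) : Prop :=
  Set.SurjOn (mulPow I l i) (gradedPiece I j) (gradedPiece I (j + i))

/-- The map `ℓ ^ i : R_j → R_{j+i}` has maximal rank. -/
def MulPowHasMaximalRank {n : ℕ} {𝕜 : Type*} [Field 𝕜]
    (I : Ideal (MvPolynomial (Fin n) 𝕜)) (l : MvPolynomial (Fin n) 𝕜) (i j : ℕ) : Prop :=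
  MulPowInjective I l i j ∨ MulPowSurjective I l i j

/-- `R = S/I` has the strong Lefschetz property: for some linear form `ℓ`, all the maps
`ℓ ^ i : R_j → R_{j+i}`, `i ≥ 1`, have maximal rank. -/
def HasSLP {n : ℕ} {𝕜 : Type*} [Field 𝕜] (I : Ideal (MvPolynomial (Fin n) 𝕜)) : Prop :=
  ∃ l : MvPolynomial (Fin n) 𝕜, l.IsHomogeneous 1 ∧
    ∀ i : ℕ, 1 ≤ i → ∀ j : ℕ, MulPowHasMaximalRank I l i j

/-- The linear form `x_1 + ⋯ + x_n`. -/
def sumVars (n : ℕ) (𝕜 : Type*) [Field 𝕜] : MvPolynomial (Fin n) 𝕜 :=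
  ∑ k : Fin n, X k

/-- The ideal generated by all monomials of degree `d` that do not occur in `f`. -/
def offSupportIdeal {n : ℕ} {𝕜 : Type*} [Field 𝕜] (d : ℕ) (f : MvPolynomial (Fin n) 𝕜) :
    Ideal (MvPolynomial (Fin n) 𝕜) :=
  Ideal.span ((fun a => (monomial a (1 : 𝕜))) ''
    {a : Fin n →₀ ℕ | a.degree = d ∧ a ∉ f.support})

end

/-! The proof runs through Macaulay duality. In characteristic zero, multiplication by `ℓ` is
adjoint to `L = ∑ ∂/∂x_k`, so `ℓ^i : R_j → R_{j+i}` fails to be surjective exactly when some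
non-zero form `f` of degree `j+i`, with all its monomials outside `I`, satisfies `L^i f = 0`.

The key estimate is `le_card_support_of_iterate_dirDeriv_eq_zero`: such a form of degree `e` has at
least `e-i+2` terms. Failure of injectivity forces `j+i ≥ d`, since `I` is zero in lower degrees.
Partial derivatives commute with `L` and keep the monomials outside `I`, so `f` can be brought down
to degree `d`, where the estimate gives (ii).

For (i), injectivity on a one-dimensional `R_0` excludes `j = 0`, so `f` has at least `j+2 ≥ 3`
terms. If `j+i = d`, this suffices, except that for `d = 2` the form is squarefree and
`four_le_card_support_of_squarefree` is needed. If `j+i > d`, there are two monomials of degree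
`d+1` outside `I`, and their divisors of degree `d` are numerous enough.

For sharpness, `I` omits just the monomials of a form such as `x^p (y-z)^m` or `(x-y)(z-w)`. For any
other linear form, rescaling the coefficients of the binomials gives a form killed by the dual
derivation without new monomials. Surjectivity thus fails, and a comparison of dimensions excludes
injectivity. -/

/-- The derivation `∑ c_k ∂/∂x_k`. -/
noncomputable def dirDeriv {n : ℕ} {𝕜 : Type*} [Field 𝕜] (c : Fin n → 𝕜) :
    Derivation 𝕜 (MvPolynomial (Fin n) 𝕜) (MvPolynomial (Fin n) 𝕜) :=
  ∑ k, c k • pderiv k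

/-! ### Forms killed by a power of a directional derivative, and their number of terms -/

section DirDeriv

variable {n : ℕ} {𝕜 : Type*} [Field 𝕜]

theorem dirDeriv_apply (c : Fin n → 𝕜) (f : MvPolynomial (Fin n) 𝕜) :
    dirDeriv c f = ∑ k, c k • pderiv k f := by
  have h := congrFun (map_sum (Derivation.coeFnAddMonoidHom (R := 𝕜)
    (A := MvPolynomial (Fin n) 𝕜) (M := MvPolynomial (Fin n) 𝕜))
    (fun k => c k • pderiv k) Finset.univ) f
  rw [Finset.sum_apply] at h
  exact h

theorem dirDeriv_X (c : Fin n → 𝕜) (k : Fin n) : dirDeriv c (X k) = C (c k) := by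
  classical
  simp [dirDeriv_apply, pderiv_X, Pi.single_apply, smul_eq_C_mul]

theorem isHomogeneous_dirDeriv (c : Fin n → 𝕜) {f : MvPolynomial (Fin n) 𝕜} {e : ℕ}
    (hf : f.IsHomogeneous e) : (dirDeriv c f).IsHomogeneous (e - 1) := by
  rw [dirDeriv_apply]
  refine IsHomogeneous.sum _ _ _ fun k _ => ?_
  rw [smul_eq_C_mul]
  exact hf.pderiv.C_mul _

theorem iterate_dirDeriv_eq_zero (c : Fin n → 𝕜) {f : MvPolynomial (Fin n) 𝕜} {e : ℕ}
    (hf : f.IsHomogeneous e) : (dirDeriv c)^[e + 1] f = 0 := by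
  induction e generalizing f with
  | zero =>
    rw [← totalDegree_zero_iff_isHomogeneous, totalDegree_eq_zero_iff_eq_C] at hf
    rw [hf]
    simp
  | succ e ih =>
    rw [Function.iterate_succ_apply]
    exact ih (isHomogeneous_dirDeriv c hf)

theorem iterate_dirDeriv_zero (c : Fin n → 𝕜) (i : ℕ) : (dirDeriv c)^[i] 0 = 0 :=
  iterate_map_zero (dirDeriv c) i

theorem dirDeriv_pderiv_comm (c : Fin n → 𝕜) (k : Fin n) (f : MvPolynomial (Fin n) 𝕜) :
    dirDeriv c (pderiv k f) = pderiv k (dirDeriv c f) := by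
  ext a
  simp only [dirDeriv_apply, map_sum, Derivation.map_smul, coeff_sum, coeff_smul, coeff_pderiv]
  refine Finset.sum_congr rfl fun m _ => ?_
  rw [add_right_comm a]
  by_cases h : m = k
  · subst h; rfl
  · simp [h, Ne.symm h, mul_right_comm]

theorem iterate_dirDeriv_pderiv (c : Fin n → 𝕜) (k : Fin n) (f : MvPolynomial (Fin n) 𝕜)
    (i : ℕ) : (dirDeriv c)^[i] (pderiv k f) = pderiv k ((dirDeriv c)^[i] f) := by
  induction i with
  | zero => rfl
  | succ i ih => rw [Function.iterate_succ_apply', ih, dirDeriv_pderiv_comm,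
      Function.iterate_succ_apply']

/-- Elements killed by a directional derivative are constants for it. -/
theorem iterate_dirDeriv_mul_of_eq_zero (c : Fin n → 𝕜) {u : MvPolynomial (Fin n) 𝕜}
    (hu : dirDeriv c u = 0) (v : MvPolynomial (Fin n) 𝕜) (i : ℕ) :
    (dirDeriv c)^[i] (v * u) = (dirDeriv c)^[i] v * u := by
  induction i with
  | zero => rfl
  | succ i ih =>
    simp only [Function.iterate_succ_apply', ih]
    simp [hu, mul_comm]

theorem iterate_dirDeriv_X_mul (k : Fin n) (h : MvPolynomial (Fin n) 𝕜) (i : ℕ) :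
    (dirDeriv 1)^[i + 1] (X k * h) =
      X k * (dirDeriv 1)^[i + 1] h + ((i + 1 : ℕ) : MvPolynomial (Fin n) 𝕜) *
        (dirDeriv 1)^[i] h := by
  induction i with
  | zero =>
    simp [dirDeriv_X, mul_comm, add_comm]
  | succ i ih =>
    rw [Function.iterate_succ_apply', ih, map_add, Derivation.leibniz, Derivation.leibniz,
      dirDeriv_X, Derivation.map_natCast, ← Function.iterate_succ_apply' (dirDeriv 1),
      ← Function.iterate_succ_apply' (dirDeriv 1)]
    simp only [smul_eq_mul, Pi.one_apply, map_one]
    push_cast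
    ring

/-- Write `L` for `dirDeriv 1`. By the product formula, `L^(m+1) (x_k h) = 0` and `L^(m+1) h = 0`
give `(m+1) L^m h = 0`. Since a high power of `L` kills `h` for degree reasons, the exponent can be
lowered one step at a time down to `i`. -/
theorem iterate_dirDeriv_eq_zero_of_X_mul [CharZero 𝕜] (k : Fin n)
    {h : MvPolynomial (Fin n) 𝕜} {e : ℕ} (hh : h.IsHomogeneous e) {i : ℕ}
    (hi : (dirDeriv 1)^[i + 1] (X k * h) = 0) : (dirDeriv 1)^[i] h = 0 := by
  have key : ∀ t, (dirDeriv (1 : Fin n → 𝕜))^[i + t] h = 0 → (dirDeriv 1)^[i] h = 0 := by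
    intro t
    induction t with
    | zero => exact id
    | succ t ih =>
      intro ht
      refine ih ?_
      have h1 := iterate_dirDeriv_X_mul (𝕜 := 𝕜) k h (i + t)
      have h2 : (dirDeriv (1 : Fin n → 𝕜))^[i + t + 1] (X k * h) = 0 := by
        rw [show i + t + 1 = t + (i + 1) by ring, Function.iterate_add_apply, hi,
          iterate_dirDeriv_zero]
      rw [h2, add_assoc, ht, mul_zero, zero_add, eq_comm, mul_eq_zero] at h1
      exact h1.resolve_left (Nat.cast_ne_zero.2 (Nat.succ_ne_zero _))
  refine key (e + 1) ?_
  rw [Function.iterate_add_apply, iterate_dirDeriv_eq_zero 1 hh, iterate_dirDeriv_zero]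

theorem exists_pderiv_ne_zero [CharZero 𝕜] {f : MvPolynomial (Fin n) 𝕜} {e : ℕ}
    (hf : f.IsHomogeneous e) (he : e ≠ 0) (h0 : f ≠ 0) : ∃ k, pderiv k f ≠ 0 := by
  obtain ⟨a, ha⟩ := support_nonempty.2 h0
  have hdeg : a.degree = e := by
    by_contra h
    exact (mem_support_iff.1 ha) (hf.coeff_eq_zero h)
  have : ∃ k, a k ≠ 0 := by
    by_contra! h
    apply he
    rw [← hdeg, Finsupp.degree_eq_sum]
    simp [h]
  obtain ⟨k, hk⟩ := this
  refine ⟨k, fun h => ?_⟩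
  have h1 := congrArg (coeff (a - Finsupp.single k 1)) h
  rw [coeff_pderiv, tsub_add_cancel_of_le (by simpa [Nat.one_le_iff_ne_zero] using hk),
    coeff_zero, mul_eq_zero] at h1
  rcases h1 with h1 | h1
  · exact mem_support_iff.1 ha h1
  · exact Nat.cast_add_one_ne_zero _ h1

theorem card_support_pderiv_le (f : MvPolynomial (Fin n) 𝕜) (k : Fin n) :
    (pderiv k f).support.card ≤ {a ∈ f.support | a k ≠ 0}.card := by
  refine Finset.card_le_card_of_injOn (fun a => a + Finsupp.single k 1) ?_
    (fun a _ b _ h => add_right_cancel h)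
  intro a ha
  have ha : coeff a (pderiv k f) ≠ 0 := mem_support_iff.1 ha
  rw [coeff_pderiv] at ha
  simpa using left_ne_zero_of_mul ha

/-- A non-zero form of degree `d` killed by the `i`-th power of `∑ ∂/∂x_k` has at least
`d - i + 2` terms. -/
theorem le_card_support_of_iterate_dirDeriv_eq_zero [CharZero 𝕜] {d i : ℕ}
    {f : MvPolynomial (Fin n) 𝕜} (hf : f.IsHomogeneous d) (h0 : f ≠ 0)
    (hL : (dirDeriv 1)^[i] f = 0) : d + 2 ≤ f.support.card + i := by
  induction d generalizing f i with
  | zero =>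
    have h1 := Finset.card_pos.2 (support_nonempty.2 h0)
    have : i ≠ 0 := by rintro rfl; exact h0 hL
    omega
  | succ d ih =>
    obtain ⟨k, hk⟩ := exists_pderiv_ne_zero hf (Nat.succ_ne_zero d) h0
    have hi0 : i ≠ 0 := by rintro rfl; exact h0 hL
    -- If every term contains `x_k`, dividing by `x_k` lowers both the degree and `i` by one and
    -- keeps the number of terms.
    by_cases hall : ∀ a ∈ f.support, a k ≠ 0
    · obtain ⟨h, rfl⟩ : X k ∣ f := by
        rw [X_dvd_iff_modMonomial_eq_zero]
        ext a
        by_cases hle : Finsupp.single k 1 ≤ a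
        · simp [coeff_modMonomial_of_le _ hle]
        · rw [coeff_modMonomial_of_not_le _ hle, coeff_zero]
          by_contra hne
          exact hle (by simpa [Nat.one_le_iff_ne_zero] using hall a (mem_support_iff.2 hne))
      have hh : h.IsHomogeneous d := by
        intro a ha
        have := @hf (Finsupp.single k 1 + a) (by rwa [coeff_X_mul])
        simp only [Finsupp.weight_single, map_add] at this
        have h2 : (1 : ℕ) • (1 : Fin n → ℕ) k = 1 := by simp
        omega
      obtain ⟨i, rfl⟩ := Nat.exists_eq_succ_of_ne_zero hi0
      have := ih hh (right_ne_zero_of_mul h0) (iterate_dirDeriv_eq_zero_of_X_mul k hh hL)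
      rw [support_X_mul, Finset.card_map]
      omega
    -- Otherwise `∂_k f` is killed by the same power, its degree is one lower, and at least the term
    -- free of `x_k` is lost.
    · have h1 := ih (i := i) (hf.pderiv (i := k)) hk
        (by rw [iterate_dirDeriv_pderiv, hL, map_zero])
      have h2 := card_support_pderiv_le f k
      push Not at hall
      obtain ⟨a, ha, hak⟩ := hall
      have h3 : {a ∈ f.support | a k ≠ 0}.card < f.support.card :=
        Finset.card_lt_card (Finset.filter_ssubset.2 ⟨a, ha, by simpa using hak⟩)
      omega

theorem coeff_X_mul_pderiv (f : MvPolynomial (Fin n) 𝕜) (k : Fin n) (a : Fin n →₀ ℕ) :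
    coeff a (X k * pderiv k f) = a k * coeff a f := by
  classical
  rw [coeff_X_mul']
  split_ifs with h
  · have h : 1 ≤ a k := Nat.one_le_iff_ne_zero.2 (Finsupp.mem_support_iff.1 h)
    rw [coeff_pderiv, tsub_add_cancel_of_le (by simpa using h), mul_comm]
    congr 1
    simp [Nat.cast_sub h]
  · simp [Finsupp.notMem_support_iff.1 h]

/-- A non-zero squarefree quadratic form killed by `∑ ∂/∂x_k` has at least four terms. -/
theorem four_le_card_support_of_squarefree [CharZero 𝕜]
    {f : MvPolynomial (Fin n) 𝕜} (hf : f.IsHomogeneous 2) (h0 : f ≠ 0)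
    (hsq : ∀ a ∈ f.support, ∀ k, a k ≤ 1)
    (hL : dirDeriv 1 f = 0) : 4 ≤ f.support.card := by
  obtain ⟨k, hk⟩ := exists_pderiv_ne_zero hf two_ne_zero h0
  have hLk : dirDeriv 1 (pderiv k f) = 0 := by rw [dirDeriv_pderiv_comm, hL, map_zero]
  have h1 := le_card_support_of_iterate_dirDeriv_eq_zero (i := 1) (hf.pderiv (i := k)) hk hLk
  have h2 := card_support_pderiv_le f k
  -- As `f` is squarefree, `g` is the part of `f` free of `x_k`. Since `L g = -∂_k f` is non-zero
  -- and killed by `L`, the general bound gives two terms in `g`; it also gives two in `∂_k f`,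
  -- hence two terms of `f` containing `x_k`.
  set g := f - X k * pderiv k f with hg
  have hLg : dirDeriv 1 g = - pderiv k f := by
    simp [hg, hL, hLk, dirDeriv_X]
  have hgh : g.IsHomogeneous 2 := hf.sub ((isHomogeneous_X 𝕜 k).mul (hf.pderiv (i := k)))
  have hg0 : g ≠ 0 := by
    intro h
    rw [h, map_zero, eq_comm, neg_eq_zero] at hLg
    exact hk hLg
  have h3 := le_card_support_of_iterate_dirDeriv_eq_zero (i := 2) hgh hg0
    (by simp [hLg, hLk])
  have h4 : g.support ⊆ {a ∈ f.support | ¬ a k ≠ 0} := by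
    intro a ha
    rw [mem_support_iff, hg, coeff_sub, coeff_X_mul_pderiv, ← one_sub_mul] at ha
    have h5 := mem_support_iff.2 (right_ne_zero_of_mul ha)
    refine Finset.mem_filter.2 ⟨h5, fun h6 => left_ne_zero_of_mul ha ?_⟩
    have : a k = 1 := le_antisymm (hsq a h5 k) (Nat.one_le_iff_ne_zero.2 h6)
    simp [this]
  have h5 := Finset.card_le_card h4
  have h6 := Finset.card_filter_add_card_filter_not (s := f.support) (fun a => a k ≠ 0)
  omega

end DirDeriv

/-! ### Monomial bases of the graded pieces, and the artinian condition -/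

section MonomialIdeal

variable {n : ℕ} {𝕜 : Type*} [Field 𝕜] {I : Ideal (MvPolynomial (Fin n) 𝕜)} {d : ℕ}

theorem IsMonomialIdealGeneratedInDegree.mem_iff (hI : IsMonomialIdealGeneratedInDegree I d)
    (p : MvPolynomial (Fin n) 𝕜) : p ∈ I ↔ ∀ a ∈ p.support, monomial a (1 : 𝕜) ∈ I := by
  classical
  obtain ⟨T, -, rfl⟩ := hI
  simp only [mem_ideal_span_monomial_image, support_monomial, one_ne_zero, if_false,
    Finset.mem_singleton, forall_eq]

theorem IsMonomialIdealGeneratedInDegree.monomial_mem_iff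
    (hI : IsMonomialIdealGeneratedInDegree I d) (a : Fin n →₀ ℕ) :
    monomial a (1 : 𝕜) ∈ I ↔ ∃ b ≤ a, b.degree = d ∧ monomial b (1 : 𝕜) ∈ I := by
  classical
  obtain ⟨T, hT, rfl⟩ := hI
  simp only [mem_ideal_span_monomial_image, support_monomial, one_ne_zero, if_false,
    Finset.mem_singleton, forall_eq]
  constructor
  · rintro ⟨b, hb, hba⟩
    exact ⟨b, hba, hT b hb, b, hb, le_rfl⟩
  · rintro ⟨b, hba, -, t, ht, htb⟩
    exact ⟨t, ht, htb.trans hba⟩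

theorem monomial_one_mem_of_le {a b : Fin n →₀ ℕ} (h : a ≤ b)
    (ha : monomial a (1 : 𝕜) ∈ I) : monomial b (1 : 𝕜) ∈ I :=
  I.mem_of_dvd (monomial_one_dvd_monomial_one.2 h) ha

variable (I) in
/-- The exponents of the monomials of degree `j` outside `I`. -/
def standardExponents (j : ℕ) : Set (Fin n →₀ ℕ) :=
  {a | a.degree = j ∧ monomial a (1 : 𝕜) ∉ I}

theorem finite_standardExponents (j : ℕ) : (standardExponents I j).Finite :=
  (Finsupp.finite_of_degree_eq j).subset fun _ h => h.1

theorem monomial_eq_smul_one (a : Fin n →₀ ℕ) (r : 𝕜) :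
    monomial a r = r • monomial a (1 : 𝕜) := by
  simp [smul_monomial]

theorem mk_mem_gradedPiece {p : MvPolynomial (Fin n) 𝕜} {j : ℕ} (hp : p.IsHomogeneous j) :
    Ideal.Quotient.mk I p ∈ gradedPiece I j :=
  ⟨p, hp, rfl⟩

theorem IsMonomialIdealGeneratedInDegree.linearIndependent_standardExponents
    (hI : IsMonomialIdealGeneratedInDegree I d) (j : ℕ) :
    LinearIndependent 𝕜 (fun a : standardExponents I j =>
      Ideal.Quotient.mk I (monomial a.1 (1 : 𝕜))) := by
  classical
  have := (finite_standardExponents (I := I) j).fintype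
  rw [Fintype.linearIndependent_iff]
  intro g hg a
  have h1 : Ideal.Quotient.mk I (∑ b : standardExponents I j, monomial b.1 (g b)) = 0 := by
    rw [map_sum, ← hg]
    refine Finset.sum_congr rfl fun b _ => ?_
    rw [monomial_eq_smul_one]
    exact map_smul (Ideal.Quotient.mkₐ 𝕜 I) _ _
  rw [Ideal.Quotient.eq_zero_iff_mem, hI.mem_iff] at h1
  by_contra hne
  refine a.2.2 (h1 a.1 (mem_support_iff.2 ?_))
  simpa [coeff_sum, coeff_monomial, Subtype.val_inj] using hne

theorem span_standardExponents (j : ℕ) :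
    Submodule.span 𝕜 (Set.range fun a : standardExponents I j =>
      Ideal.Quotient.mk I (monomial a.1 (1 : 𝕜))) = gradedPiece I j := by
  apply le_antisymm
  · rw [Submodule.span_le]
    rintro _ ⟨a, rfl⟩
    exact mk_mem_gradedPiece (isHomogeneous_monomial _ a.2.1)
  · rintro _ ⟨p, hp, rfl⟩
    have hp : p.IsHomogeneous j := hp
    rw [p.as_sum, map_sum]
    refine Submodule.sum_mem _ fun a ha => ?_
    rw [monomial_eq_smul_one, map_smul]
    refine Submodule.smul_mem _ _ ?_
    by_cases haI : monomial a (1 : 𝕜) ∈ I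
    · have : (Ideal.Quotient.mkₐ 𝕜 I).toLinearMap (monomial a (1 : 𝕜)) = 0 :=
        Ideal.Quotient.eq_zero_iff_mem.2 haI
      rw [this]
      exact Submodule.zero_mem _
    · refine Submodule.subset_span ⟨⟨a, ?_, haI⟩, rfl⟩
      by_contra h
      exact mem_support_iff.1 ha (hp.coeff_eq_zero h)

/-- The Hilbert function of a monomial ideal counts the monomials outside the ideal. -/
theorem IsMonomialIdealGeneratedInDegree.hilbertFn_eq_ncard
    (hI : IsMonomialIdealGeneratedInDegree I d) (j : ℕ) :
    hilbertFn I j = (standardExponents I j).ncard := by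
  have := (finite_standardExponents (I := I) j).fintype
  rw [hilbertFn, ← span_standardExponents,
    finrank_span_eq_card (hI.linearIndependent_standardExponents j),
    Set.ncard_eq_toFinset_card', Set.toFinset_card]

theorem IsMonomialIdealGeneratedInDegree.card_le_hilbertFn
    (hI : IsMonomialIdealGeneratedInDegree I d) {j : ℕ} {s : Finset (Fin n →₀ ℕ)}
    (hs : ↑s ⊆ standardExponents I j) : s.card ≤ hilbertFn I j := by
  rw [hI.hilbertFn_eq_ncard, ← Set.ncard_coe_finset]
  exact Set.ncard_le_ncard hs (finite_standardExponents j)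

/-- The chain of powers of `x_k` stabilises in the quotient, so `x_k^(m+1) g - x_k^m` lies in `I`
for some `m` and `g`. The monomial `x_k^m` cannot cancel, so it lies in `I`, and a monomial of `I`
of degree `d` dividing it can only be `x_k^d`. -/
theorem IsMonomialIdealGeneratedInDegree.single_mem_of_isArtinianRing
    (hI : IsMonomialIdealGeneratedInDegree I d)
    (hA : IsArtinianRing (MvPolynomial (Fin n) 𝕜 ⧸ I)) (k : Fin n) :
    monomial (Finsupp.single k d) (1 : 𝕜) ∈ I := by
  classical
  obtain ⟨m, y, hy⟩ := IsArtinian.exists_pow_succ_smul_dvd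
    (Ideal.Quotient.mk I (X k)) (1 : MvPolynomial (Fin n) 𝕜 ⧸ I)
  obtain ⟨g, rfl⟩ := Ideal.Quotient.mk_surjective y
  simp only [smul_eq_mul, mul_one] at hy
  rw [← map_pow, ← map_mul, ← map_pow, Ideal.Quotient.eq, hI.mem_iff] at hy
  have h1 : monomial (Finsupp.single k m) (1 : 𝕜) ∈ I := by
    refine hy _ (mem_support_iff.2 ?_)
    rw [coeff_sub, X_pow_eq_monomial, X_pow_eq_monomial, coeff_monomial_mul', if_neg]
    · simp
    · intro h
      simpa using h k
  obtain ⟨b, hb, hbd, hbI⟩ := (hI.monomial_mem_iff _).1 h1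
  have h2 : b = Finsupp.single k (b k) := by
    ext t
    by_cases ht : t = k
    · simp [ht]
    · have := hb t
      rw [Finsupp.single_apply, if_neg (Ne.symm ht)] at this
      rw [Finsupp.single_apply, if_neg (Ne.symm ht)]
      omega
  have h3 : b k = d := by rw [← hbd, h2, Finsupp.degree_single]; simp
  rwa [h2, h3] at hbI

theorem isArtinianRing_of_single_mem (d : ℕ)
    (h : ∀ k, monomial (Finsupp.single k d) (1 : 𝕜) ∈ I) :
    IsArtinianRing (MvPolynomial (Fin n) 𝕜 ⧸ I) := by
  have hint : Algebra.IsIntegral 𝕜 (MvPolynomial (Fin n) 𝕜 ⧸ I) := by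
    refine ⟨fun y => ?_⟩
    obtain ⟨p, rfl⟩ := Ideal.Quotient.mk_surjective y
    induction p using MvPolynomial.induction_on with
    | C a => exact isIntegral_algebraMap (R := 𝕜) (x := a)
    | add p q hp hq => rw [map_add]; exact hp.add hq
    | mul_X p k hp =>
      rw [map_mul]
      -- The exponent is `d + 1` because it has to be positive and `d = 0` is allowed here.
      refine hp.mul (IsIntegral.of_pow (n := d + 1) (Nat.succ_pos d) ?_)
      rw [pow_succ, ← map_pow, X_pow_eq_monomial, Ideal.Quotient.eq_zero_iff_mem.2 (h k),
        zero_mul]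
      exact isIntegral_zero
  have : Algebra.FiniteType 𝕜 (MvPolynomial (Fin n) 𝕜 ⧸ I) :=
    Algebra.FiniteType.of_surjective (Ideal.Quotient.mkₐ 𝕜 I) Ideal.Quotient.mk_surjective
  have := Algebra.IsIntegral.finite (R := 𝕜) (A := MvPolynomial (Fin n) 𝕜 ⧸ I)
  exact IsArtinianRing.of_finite 𝕜 _

end MonomialIdeal

/-! ### Apolarity: non-surjectivity in terms of killed forms -/

section Apolarity

variable {n : ℕ} {𝕜 : Type*} [Field 𝕜]

/-- The linear form `∑ c_k x_k`. -/
noncomputable def linearForm (c : Fin n → 𝕜) : MvPolynomial (Fin n) 𝕜 :=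
  ∑ k, C (c k) * X k

theorem sumVars_eq_linearForm : sumVars n 𝕜 = linearForm 1 := by
  simp [sumVars, linearForm]

theorem isHomogeneous_linearForm (c : Fin n → 𝕜) : (linearForm c).IsHomogeneous 1 :=
  IsHomogeneous.sum _ _ _ fun k _ => isHomogeneous_C_mul_X (c k) k

theorem exists_eq_linearForm {l : MvPolynomial (Fin n) 𝕜} (hl : l.IsHomogeneous 1) :
    ∃ c, l = linearForm c := by
  have h : l ∈ homogeneousSubmodule (Fin n) 𝕜 1 := hl
  rw [homogeneousSubmodule_one_eq_span_X, Submodule.mem_span_range_iff_exists_fun] at h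
  obtain ⟨c, rfl⟩ := h
  exact ⟨c, by simp [linearForm, smul_eq_C_mul]⟩

/-- The apolarity pairing: `x^a` is sent to the constant term of `∂^a f`. -/
noncomputable def apolar (f : MvPolynomial (Fin n) 𝕜) : MvPolynomial (Fin n) 𝕜 →ₗ[𝕜] 𝕜 :=
  (basisMonomials (Fin n) 𝕜).constr 𝕜 fun a => (∏ k, ((a k).factorial : 𝕜)) * coeff a f

theorem apolar_monomial_one (f : MvPolynomial (Fin n) 𝕜) (a : Fin n →₀ ℕ) :
    apolar f (monomial a 1) = (∏ k, ((a k).factorial : 𝕜)) * coeff a f := by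
  have := (basisMonomials (Fin n) 𝕜).constr_basis 𝕜
    (fun a => (∏ k, ((a k).factorial : 𝕜)) * coeff a f) a
  rwa [coe_basisMonomials] at this

theorem linearMap_ext_monomial_one {M : Type*} [AddCommGroup M] [Module 𝕜 M]
    {φ ψ : MvPolynomial (Fin n) 𝕜 →ₗ[𝕜] M}
    (h : ∀ a, φ (monomial a 1) = ψ (monomial a 1)) : φ = ψ := by
  refine (basisMonomials (Fin n) 𝕜).ext fun a => ?_
  simpa using h a

theorem prod_factorial_ne_zero [CharZero 𝕜] (a : Fin n →₀ ℕ) :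
    (∏ k, ((a k).factorial : 𝕜)) ≠ 0 :=
  Finset.prod_ne_zero_iff.2 fun _ _ => Nat.cast_ne_zero.2 (Nat.factorial_ne_zero _)

theorem apolar_monomial_one_eq_zero_iff [CharZero 𝕜] (f : MvPolynomial (Fin n) 𝕜)
    (a : Fin n →₀ ℕ) : apolar f (monomial a 1) = 0 ↔ a ∉ f.support := by
  rw [apolar_monomial_one, mul_eq_zero, or_iff_right (prod_factorial_ne_zero a),
    notMem_support_iff]

theorem prod_factorial_add_single (a : Fin n →₀ ℕ) (k : Fin n) :
    (∏ t, (((a + Finsupp.single k 1 : Fin n →₀ ℕ) t).factorial : 𝕜)) =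
      (a k + 1) * ∏ t, ((a t).factorial : 𝕜) := by
  rw [← Finset.mul_prod_erase _ _ (Finset.mem_univ k),
    ← Finset.mul_prod_erase _ (fun t => ((a t).factorial : 𝕜)) (Finset.mem_univ k), ← mul_assoc]
  congr 1
  · simp [Nat.factorial_succ]
  · refine Finset.prod_congr rfl fun t ht => ?_
    simp [(Finset.ne_of_mem_erase ht).symm]

/-- The factorial weights make multiplication by `x_k` adjoint to `∂_k`: the factor `a_k + 1` from
differentiation is the one by which the factorials of `a` and `a + e_k` differ. -/
theorem apolar_linearForm_mul (c : Fin n → 𝕜) (f g : MvPolynomial (Fin n) 𝕜) :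
    apolar f (linearForm c * g) = apolar (dirDeriv c f) g := by
  have : apolar f ∘ₗ LinearMap.mulLeft 𝕜 (linearForm c) = apolar (dirDeriv c f) := by
    refine linearMap_ext_monomial_one fun a => ?_
    rw [LinearMap.comp_apply, LinearMap.mulLeft_apply, linearForm, Finset.sum_mul, map_sum,
      apolar_monomial_one, dirDeriv_apply, coeff_sum, Finset.mul_sum]
    refine Finset.sum_congr rfl fun k _ => ?_
    rw [mul_assoc, ← smul_eq_C_mul, map_smul, X, monomial_mul, one_mul, add_comm,
      apolar_monomial_one, prod_factorial_add_single, coeff_smul, coeff_pderiv]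
    simp only [smul_eq_mul]
    ring
  exact LinearMap.congr_fun this g

theorem apolar_linearForm_pow_mul (c : Fin n → 𝕜) (i : ℕ) (f g : MvPolynomial (Fin n) 𝕜) :
    apolar f (linearForm c ^ i * g) = apolar ((dirDeriv c)^[i] f) g := by
  induction i generalizing f with
  | zero => simp
  | succ i ih => rw [pow_succ', mul_assoc, apolar_linearForm_mul, ih, Function.iterate_succ_apply]

theorem apolar_zero : apolar (0 : MvPolynomial (Fin n) 𝕜) = 0 :=
  linearMap_ext_monomial_one fun a => by simp [apolar_monomial_one]

theorem apolar_eq_zero_of_support {f g : MvPolynomial (Fin n) 𝕜}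
    (h : ∀ a ∈ g.support, a ∉ f.support) : apolar f g = 0 := by
  rw [g.as_sum, map_sum]
  refine Finset.sum_eq_zero fun a ha => ?_
  rw [monomial_eq_smul_one, map_smul, apolar_monomial_one, notMem_support_iff.1 (h a ha)]
  simp

variable {I : Ideal (MvPolynomial (Fin n) 𝕜)} {d : ℕ}

/-- Pairing with `f` kills `I`, whose monomials avoid the support of `f`, and kills all multiples of
the power of the linear form. It does not kill a monomial occurring in `f`, so that monomial is not
in the image. -/
theorem IsMonomialIdealGeneratedInDegree.not_mulPowSurjective [CharZero 𝕜]
    (hI : IsMonomialIdealGeneratedInDegree I d) {i j : ℕ} {c : Fin n → 𝕜}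
    {f : MvPolynomial (Fin n) 𝕜} (h0 : f ≠ 0) (hs : ↑f.support ⊆ standardExponents I (j + i))
    (hL : (dirDeriv c)^[i] f = 0) : ¬ MulPowSurjective I (linearForm c) i j := by
  intro hsurj
  obtain ⟨a, ha⟩ := support_nonempty.2 h0
  obtain ⟨_, ⟨g, hg, rfl⟩, hq⟩ :=
    hsurj (mk_mem_gradedPiece (isHomogeneous_monomial (1 : 𝕜) (hs ha).1))
  have hq : Ideal.Quotient.mk I (linearForm c ^ i * g) = Ideal.Quotient.mk I (monomial a 1) := by
    rw [← hq]
    simp [mulPow]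
  rw [Ideal.Quotient.eq, hI.mem_iff] at hq
  have h1 : apolar f (linearForm c ^ i * g - monomial a 1) = 0 :=
    apolar_eq_zero_of_support fun b hb hbf => (hs hbf).2 (hq b hb)
  rw [map_sub, apolar_linearForm_pow_mul, hL, apolar_zero, LinearMap.zero_apply, zero_sub,
    neg_eq_zero, apolar_monomial_one_eq_zero_iff] at h1
  exact h1 ha

/-- A linear functional that vanishes on the image but not on all of `R_{j+i}` is represented by a
form: its value on `x^a`, divided by the factorials of `a`, is the coefficient of `x^a`. -/
theorem exists_of_not_mulPowSurjective [CharZero 𝕜] {i j : ℕ} {c : Fin n → 𝕜}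
    (h : ¬ MulPowSurjective I (linearForm c) i j) :
    ∃ f : MvPolynomial (Fin n) 𝕜, f ≠ 0 ∧ ↑f.support ⊆ standardExponents I (j + i) ∧
      (dirDeriv c)^[i] f = 0 := by
  classical
  obtain ⟨q, hq, hqW⟩ : ∃ q ∈ gradedPiece I (j + i),
      q ∉ (gradedPiece I j).map (mulPow I (linearForm c) i) := Set.not_subset.1 h
  obtain ⟨ψ, hψq, hψW⟩ := Submodule.exists_dual_map_eq_bot_of_notMem hqW inferInstance
  have hψ : ∀ g : MvPolynomial (Fin n) 𝕜, g.IsHomogeneous j →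
      ψ (Ideal.Quotient.mk I (linearForm c ^ i * g)) = 0 := by
    intro g hg
    have h1 : ψ (mulPow I (linearForm c) i (Ideal.Quotient.mk I g)) ∈
        ((gradedPiece I j).map (mulPow I (linearForm c) i)).map ψ :=
      Submodule.mem_map_of_mem (Submodule.mem_map_of_mem (mk_mem_gradedPiece hg))
    rw [hψW, Submodule.mem_bot] at h1
    simpa [mulPow] using h1
  let f : MvPolynomial (Fin n) 𝕜 := ∑ a ∈ (Finsupp.finite_of_degree_eq (j + i)).toFinset,
    monomial a (ψ (Ideal.Quotient.mk I (monomial a 1)) / ∏ k, ((a k).factorial : 𝕜))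
  have hcoeff : ∀ a, coeff a f = if a.degree = j + i then
      ψ (Ideal.Quotient.mk I (monomial a 1)) / ∏ k, ((a k).factorial : 𝕜) else 0 := by
    intro a
    simp [f, coeff_sum, coeff_monomial]
  -- The functional `ψ` is unconstrained in other degrees, whereas `f` lives in degree `j + i`;
  -- hence the projection.
  have hap : apolar f =
      ψ ∘ₗ (Ideal.Quotient.mkₐ 𝕜 I).toLinearMap ∘ₗ homogeneousComponent (j + i) := by
    refine linearMap_ext_monomial_one fun a => ?_
    rw [apolar_monomial_one, hcoeff, LinearMap.comp_apply, LinearMap.comp_apply,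
      homogeneousComponent_of_mem (isHomogeneous_monomial (1 : 𝕜) rfl)]
    by_cases ha : a.degree = j + i
    · rw [if_pos ha, if_pos ha.symm, mul_div_cancel₀ _ (prod_factorial_ne_zero a)]
      rfl
    · rw [if_neg ha, if_neg (Ne.symm ha), map_zero, map_zero, mul_zero]
  refine ⟨f, ?_, ?_, ?_⟩
  · intro h0
    obtain ⟨p, hp, rfl⟩ := hq
    apply hψq
    have h1 := LinearMap.congr_fun hap p
    rw [h0, apolar_zero, LinearMap.comp_apply, LinearMap.comp_apply,
      homogeneousComponent_of_mem hp, if_pos rfl] at h1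
    exact h1.symm
  · intro a ha
    have ha : coeff a f ≠ 0 := mem_support_iff.1 ha
    rw [hcoeff] at ha
    split_ifs at ha with hd
    · refine ⟨hd, fun haI => ha ?_⟩
      rw [Ideal.Quotient.eq_zero_iff_mem.2 haI, map_zero, zero_div]
    · exact absurd rfl ha
  -- Up to factorials, the coefficient at `b` is the pairing of `f` with the power times `x^b`. It
  -- vanishes by the choice of `ψ` if `b` has degree `j`, and by degree otherwise.
  · ext b
    rw [coeff_zero, ← notMem_support_iff, ← apolar_monomial_one_eq_zero_iff,
      ← apolar_linearForm_pow_mul, hap, LinearMap.comp_apply, LinearMap.comp_apply]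
    have hhom := ((isHomogeneous_linearForm c).pow i).mul
      (isHomogeneous_monomial (1 : 𝕜) (rfl : b.degree = b.degree))
    rw [homogeneousComponent_of_mem hhom]
    split_ifs with hb
    · exact hψ _ (isHomogeneous_monomial _ (by omega))
    · simp

end Apolarity

/-! ### Reduction to degree `d`, and the bound in (ii) -/

section LowerBound

variable {n : ℕ} {𝕜 : Type*} [Field 𝕜] {I : Ideal (MvPolynomial (Fin n) 𝕜)} {d : ℕ}

theorem isHomogeneous_of_support_subset {f : MvPolynomial (Fin n) 𝕜} {e : ℕ}
    (hs : ↑f.support ⊆ standardExponents I e) : f.IsHomogeneous e := by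
  intro a ha
  have h := (hs (mem_support_iff.2 ha)).1
  rw [Finsupp.degree_eq_weight_one] at h
  exact h

theorem support_pderiv_subset {f : MvPolynomial (Fin n) 𝕜} {e : ℕ}
    (hs : ↑f.support ⊆ standardExponents I (e + 1)) (k : Fin n) :
    ↑(pderiv k f).support ⊆ standardExponents I e := by
  intro a ha
  have ha : coeff a (pderiv k f) ≠ 0 := mem_support_iff.1 ha
  rw [coeff_pderiv] at ha
  have h1 := hs (mem_support_iff.2 (left_ne_zero_of_mul ha))
  refine ⟨?_, fun haI => h1.2 (monomial_one_mem_of_le le_self_add haI)⟩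
  have := h1.1
  rw [map_add, Finsupp.degree_single] at this
  omega

/-- Partial derivatives bring a form in the inverse system killed by the `i`-th power of
`∑ c_k ∂/∂x_k` down to any smaller degree. -/
theorem exists_iterate_dirDeriv_eq_zero_of_le [CharZero 𝕜] {c : Fin n → 𝕜} {i e : ℕ}
    (hde : d ≤ e) {f : MvPolynomial (Fin n) 𝕜} (h0 : f ≠ 0)
    (hs : ↑f.support ⊆ standardExponents I e) (hL : (dirDeriv c)^[i] f = 0) :
    ∃ g : MvPolynomial (Fin n) 𝕜, g ≠ 0 ∧ ↑g.support ⊆ standardExponents I d ∧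
      (dirDeriv c)^[i] g = 0 := by
  induction e, hde using Nat.le_induction generalizing f with
  | base => exact ⟨f, h0, hs, hL⟩
  | succ e he ih =>
    obtain ⟨k, hk⟩ :=
      exists_pderiv_ne_zero (isHomogeneous_of_support_subset hs) (Nat.succ_ne_zero e) h0
    exact ih hk (support_pderiv_subset hs k) (by rw [iterate_dirDeriv_pderiv, hL, map_zero])

theorem linearForm_one_ne_zero (hn : 0 < n) : linearForm (1 : Fin n → 𝕜) ≠ 0 := by
  intro h
  have := congrArg (eval (Pi.single (⟨0, hn⟩ : Fin n) (1 : 𝕜))) h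
  simp [linearForm] at this

theorem mulPowInjective_of_forall {l : MvPolynomial (Fin n) 𝕜} {i j : ℕ}
    (h : ∀ p : MvPolynomial (Fin n) 𝕜, p.IsHomogeneous j → l ^ i * p ∈ I → p ∈ I) :
    MulPowInjective I l i j := by
  rintro _ ⟨p, hp, rfl⟩ _ ⟨q, hq, rfl⟩ hpq
  refine Ideal.Quotient.eq.2 (h _ (IsHomogeneous.sub hp hq) ?_)
  rw [mul_sub, ← Ideal.Quotient.eq]
  simpa [mulPow] using hpq

/-- Below degree `d` the ideal contains no non-zero form, and the polynomial ring is a domain. -/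
theorem IsMonomialIdealGeneratedInDegree.mulPowInjective_of_lt
    (hI : IsMonomialIdealGeneratedInDegree I d) {l : MvPolynomial (Fin n) 𝕜}
    (hl : l.IsHomogeneous 1) (hl0 : l ≠ 0) {i j : ℕ} (hij : j + i < d) :
    MulPowInjective I l i j := by
  refine mulPowInjective_of_forall fun p hp hmem => ?_
  by_cases hp0 : p = 0
  · rw [hp0]; exact I.zero_mem
  exfalso
  obtain ⟨a, ha⟩ := support_nonempty.2 (mul_ne_zero (pow_ne_zero i hl0) hp0)
  obtain ⟨b, hba, hbd, -⟩ := (hI.monomial_mem_iff a).1 ((hI.mem_iff _).1 hmem a ha)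
  have h1 : a.degree = 1 * i + j := by
    by_contra h
    exact mem_support_iff.1 ha (((hl.pow i).mul hp).coeff_eq_zero h)
  have h2 := Finsupp.degree_mono hba
  omega

/-- For a monomial `f` of degree `e` outside `I`, the constant `L^e f` is non-zero. Pairing `f` with
`ℓ^e p`, for a constant `p`, gives `p` times this constant, while the pairing is zero if `ℓ^e p`
lies in `I`. -/
theorem IsMonomialIdealGeneratedInDegree.mulPowInjective_zero [CharZero 𝕜]
    (hI : IsMonomialIdealGeneratedInDegree I d) {e : ℕ} (he : (standardExponents I e).Nonempty) :
    MulPowInjective I (linearForm 1) e 0 := by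
  classical
  obtain ⟨a, had, haI⟩ := he
  refine mulPowInjective_of_forall fun p hp hmem => ?_
  rw [← totalDegree_zero_iff_isHomogeneous, totalDegree_eq_zero_iff_eq_C] at hp
  by_contra hpI
  have hp0 : coeff 0 p ≠ 0 := fun h => hpI (by rw [hp, h, C_0]; exact I.zero_mem)
  set f : MvPolynomial (Fin n) 𝕜 := monomial a 1 with hf
  have hsupp : f.support = {a} := by simp [hf, support_monomial]
  have hfh : f.IsHomogeneous e := isHomogeneous_monomial _ had
  have hf0 : f ≠ 0 := by simp [hf]
  -- A form of degree `e` killed by `L^e` would have at least two terms.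
  have hLf : (dirDeriv 1)^[e] f ≠ 0 := by
    intro h
    have := le_card_support_of_iterate_dirDeriv_eq_zero hfh hf0 h
    rw [hsupp, Finset.card_singleton] at this
    omega
  have hLh : dirDeriv 1 ((dirDeriv 1)^[e] f) = 0 := by
    rw [← Function.iterate_succ_apply' (dirDeriv 1)]
    exact iterate_dirDeriv_eq_zero 1 hfh
  have hdeg : ∀ m, m ≤ e → ((dirDeriv 1)^[m] f).IsHomogeneous (e - m) := by
    intro m
    induction m with
    | zero => intro _; exact hfh
    | succ m ih =>
      intro hm
      rw [Function.iterate_succ_apply', ← Nat.sub_sub]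
      exact isHomogeneous_dirDeriv 1 (ih (by omega))
  have hC := hdeg e le_rfl
  rw [Nat.sub_self, ← totalDegree_zero_iff_isHomogeneous, totalDegree_eq_zero_iff_eq_C] at hC
  have h1 : apolar f (linearForm 1 ^ e * p) = 0 := by
    refine apolar_eq_zero_of_support fun b hb hbf => ?_
    rw [hsupp, Finset.mem_singleton] at hbf
    subst hbf
    exact haI ((hI.mem_iff _).1 hmem b hb)
  rw [apolar_linearForm_pow_mul, hp, C_apply, monomial_eq_smul_one, map_smul, smul_eq_mul,
    mul_eq_zero, or_iff_right hp0, apolar_monomial_one_eq_zero_iff, notMem_support_iff] at h1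
  rw [h1, C_0] at hC
  exact hLf hC

theorem IsMonomialIdealGeneratedInDegree.exists_of_not_hasMaximalRank [CharZero 𝕜]
    (hI : IsMonomialIdealGeneratedInDegree I d) (hn : 0 < n) {i j : ℕ}
    (h : ¬ MulPowHasMaximalRank I (sumVars n 𝕜) i j) :
    d ≤ j + i ∧ j ≠ 0 ∧ ∃ f : MvPolynomial (Fin n) 𝕜, f ≠ 0 ∧
      ↑f.support ⊆ standardExponents I (j + i) ∧ (dirDeriv 1)^[i] f = 0 := by
  rw [sumVars_eq_linearForm, MulPowHasMaximalRank, not_or] at h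
  obtain ⟨f, h0, hs, hL⟩ := exists_of_not_mulPowSurjective h.2
  refine ⟨?_, ?_, f, h0, hs, hL⟩
  · by_contra hlt
    exact h.1 (hI.mulPowInjective_of_lt (isHomogeneous_linearForm 1)
      (linearForm_one_ne_zero hn) (by omega))
  · rintro rfl
    obtain ⟨a, ha⟩ := support_nonempty.2 h0
    exact h.1 (hI.mulPowInjective_zero ⟨a, by simpa using hs ha⟩)

theorem IsMonomialIdealGeneratedInDegree.le_hilbertFn_of_not_hasMaximalRank [CharZero 𝕜]
    (hI : IsMonomialIdealGeneratedInDegree I d) (hn : 0 < n) {i j : ℕ}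
    (h : ¬ MulPowHasMaximalRank I (sumVars n 𝕜) i j) : d + 2 ≤ hilbertFn I d + i := by
  obtain ⟨hd, -, f, h0, hs, hL⟩ := hI.exists_of_not_hasMaximalRank hn h
  obtain ⟨g, hg0, hgs, hgL⟩ := exists_iterate_dirDeriv_eq_zero_of_le hd h0 hs hL
  have h1 := le_card_support_of_iterate_dirDeriv_eq_zero
    (isHomogeneous_of_support_subset hgs) hg0 hgL
  have h2 := hI.card_le_hilbertFn hgs
  omega

/-! ### Counting the divisors of monomials outside `I`, and the bound in (i) -/

theorem apply_lt_of_mem_standardExponents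
    (hsingle : ∀ k, monomial (Finsupp.single k d) (1 : 𝕜) ∈ I) {e : ℕ} {a : Fin n →₀ ℕ}
    (ha : a ∈ standardExponents I e) (k : Fin n) : a k < d := by
  by_contra h
  refine ha.2 (monomial_one_mem_of_le ?_ (hsingle k))
  rw [Finsupp.single_le_iff]
  omega

theorem le_card_support_mul
    (hsingle : ∀ k, monomial (Finsupp.single k d) (1 : 𝕜) ∈ I) {e : ℕ} {a : Fin n →₀ ℕ}
    (ha : a ∈ standardExponents I e) : e ≤ a.support.card * (d - 1) := by
  rw [← ha.1, Finsupp.degree_apply, ← smul_eq_mul]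
  refine Finset.sum_le_card_nsmul _ _ _ fun k _ => ?_
  have := apply_lt_of_mem_standardExponents hsingle ha k
  omega

/-- The exponents of the monomials `x^a / x_k`. -/
noncomputable def lowerNeighbours (a : Fin n →₀ ℕ) : Finset (Fin n →₀ ℕ) :=
  a.support.image fun k => a - Finsupp.single k 1

theorem card_lowerNeighbours (a : Fin n →₀ ℕ) : (lowerNeighbours a).card = a.support.card := by
  refine Finset.card_image_of_injOn fun k hk t ht h => ?_
  by_contra hne
  have hk : a k ≠ 0 := Finsupp.mem_support_iff.1 hk
  have := DFunLike.congr_fun h k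
  simp [Ne.symm hne] at this
  omega

theorem lowerNeighbours_subset {e : ℕ} {a : Fin n →₀ ℕ} (ha : a ∈ standardExponents I (e + 1)) :
    ↑(lowerNeighbours a) ⊆ standardExponents I e := by
  intro b hb
  obtain ⟨k, hk, rfl⟩ := Finset.mem_image.1 (Finset.mem_coe.1 hb)
  have hk : Finsupp.single k 1 ≤ a := by
    rw [Finsupp.single_le_iff]
    exact Nat.one_le_iff_ne_zero.2 (Finsupp.mem_support_iff.1 hk)
  refine ⟨?_, fun h => ha.2 (monomial_one_mem_of_le tsub_le_self h)⟩
  have h1 := ha.1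
  rw [← tsub_add_cancel_of_le hk, map_add, Finsupp.degree_single] at h1
  omega

/-- The least common multiple of two distinct lower neighbours recovers the monomial, so distinct
monomials share at most one lower neighbour. -/
theorem sup_eq_of_mem_lowerNeighbours {a p q : Fin n →₀ ℕ} (hp : p ∈ lowerNeighbours a)
    (hq : q ∈ lowerNeighbours a) (hpq : p ≠ q) : p ⊔ q = a := by
  obtain ⟨k, -, rfl⟩ := Finset.mem_image.1 hp
  obtain ⟨t, -, rfl⟩ := Finset.mem_image.1 hq
  have hkt : k ≠ t := by rintro rfl; exact hpq rfl
  ext m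
  simp only [Finsupp.sup_apply, Finsupp.tsub_apply, Finsupp.single_apply]
  split_ifs with h1 h2
  · exact absurd (h1.trans h2.symm) hkt
  all_goals simp

/-- With at most `c` elements in the union, both sets of lower neighbours would equal it, and two
common elements would force `a = b`. -/
theorem lt_card_union_lowerNeighbours {a b : Fin n →₀ ℕ} (hab : a ≠ b) {c : ℕ} (hc : 2 ≤ c)
    (ha : c ≤ a.support.card) (hb : c ≤ b.support.card) :
    c < (lowerNeighbours a ∪ lowerNeighbours b).card := by
  classical
  by_contra! h
  rw [← card_lowerNeighbours] at ha hb
  have h1 := Finset.eq_of_subset_of_card_le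
    (Finset.subset_union_left (s₁ := lowerNeighbours a) (s₂ := lowerNeighbours b)) (h.trans ha)
  have h2 := Finset.eq_of_subset_of_card_le
    (Finset.subset_union_right (s₁ := lowerNeighbours a) (s₂ := lowerNeighbours b)) (h.trans hb)
  obtain ⟨p, hp, q, hq, hpq⟩ := Finset.one_lt_card.1 (show 1 < (lowerNeighbours a).card by omega)
  have h3 := h1.trans h2.symm
  exact hab ((sup_eq_of_mem_lowerNeighbours hp hq hpq).symm.trans
    (sup_eq_of_mem_lowerNeighbours (h3 ▸ hp) (h3 ▸ hq) hpq))

theorem two_le_card_support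
    (hsingle : ∀ k, monomial (Finsupp.single k d) (1 : 𝕜) ∈ I) {e : ℕ} (he : d ≤ e)
    (hd : 0 < d) {a : Fin n →₀ ℕ} (ha : a ∈ standardExponents I e) : 2 ≤ a.support.card := by
  have h1 := le_card_support_mul hsingle ha
  by_contra! h2
  have h3 : a.support.card * (d - 1) ≤ 1 * (d - 1) := Nat.mul_le_mul_right _ (by omega)
  omega

/-- If `R_e` has dimension at least two for some `e > d`, then so has `R_{d+1}`. -/
theorem nontrivial_standardExponents
    (hsingle : ∀ k, monomial (Finsupp.single k d) (1 : 𝕜) ∈ I) (hd : 0 < d) {e : ℕ}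
    (he : d + 1 ≤ e) (h : (standardExponents I e).Nontrivial) :
    (standardExponents I (d + 1)).Nontrivial := by
  induction e, he using Nat.le_induction with
  | base => exact h
  | succ e he ih =>
    refine ih ?_
    -- A single monomial suffices: it involves two variables, so it has two lower neighbours.
    obtain ⟨a, ha, -⟩ := h
    have h1 := two_le_card_support hsingle (by omega) hd ha
    rw [← card_lowerNeighbours] at h1
    obtain ⟨p, hp, q, hq, hpq⟩ := Finset.one_lt_card.1 h1
    exact ⟨p, lowerNeighbours_subset ha hp, q, lowerNeighbours_subset ha hq, hpq⟩

theorem IsMonomialIdealGeneratedInDegree.le_hilbertFn_of_nontrivial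
    (hI : IsMonomialIdealGeneratedInDegree I d) (hd : 2 ≤ d)
    (hsingle : ∀ k, monomial (Finsupp.single k d) (1 : 𝕜) ∈ I) {e : ℕ}
    (he : d + 1 ≤ e) (h : (standardExponents I e).Nontrivial) :
    (if d = 2 then 4 else 3) ≤ hilbertFn I d := by
  classical
  obtain ⟨a, ha, b, hb, hab⟩ := nontrivial_standardExponents hsingle (by omega) he h
  have hsub : ↑(lowerNeighbours a ∪ lowerNeighbours b) ⊆ standardExponents I d := by
    rw [Finset.coe_union]
    exact Set.union_subset (lowerNeighbours_subset ha) (lowerNeighbours_subset hb)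
  refine le_trans ?_ (hI.card_le_hilbertFn hsub)
  have h1 := le_card_support_mul hsingle ha
  have h2 := le_card_support_mul hsingle hb
  -- For `d = 2` the exponents are at most one, so a cubic monomial outside `I` involves three
  -- variables. For larger `d` only two variables are guaranteed.
  split_ifs with hd2
  · subst hd2
    exact lt_card_union_lowerNeighbours hab (c := 3) (by omega) (by omega) (by omega)
  · exact lt_card_union_lowerNeighbours hab le_rfl
      (two_le_card_support hsingle (Nat.le_succ d) (by omega) ha)
      (two_le_card_support hsingle (Nat.le_succ d) (by omega) hb)

theorem IsMonomialIdealGeneratedInDegree.le_hilbertFn_of_not_hasSLP [CharZero 𝕜]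
    (hI : IsMonomialIdealGeneratedInDegree I d) (hn : 0 < n) (hd : 2 ≤ d)
    (hA : IsArtinianRing (MvPolynomial (Fin n) 𝕜 ⧸ I)) (h : ¬ HasSLP I) :
    (if d = 2 then 4 else 3) ≤ hilbertFn I d := by
  have hsingle := hI.single_mem_of_isArtinianRing hA
  obtain ⟨i, hi, j, hij⟩ : ∃ i, 1 ≤ i ∧ ∃ j, ¬ MulPowHasMaximalRank I (sumVars n 𝕜) i j := by
    by_contra! hall
    exact h ⟨_, by rw [sumVars_eq_linearForm]; exact isHomogeneous_linearForm 1, hall⟩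
  obtain ⟨hdij, hj, f, h0, hs, hL⟩ := hI.exists_of_not_hasMaximalRank hn hij
  have hfh := isHomogeneous_of_support_subset hs
  have h1 := le_card_support_of_iterate_dirDeriv_eq_zero hfh h0 hL
  -- At this point `f` has at least `j + 2 ≥ 3` terms.
  rcases hdij.lt_or_eq with hlt | heq
  · refine hI.le_hilbertFn_of_nontrivial hd hsingle hlt ?_
    obtain ⟨a, ha, b, hb, hab⟩ := Finset.one_lt_card.1 (show 1 < f.support.card by omega)
    exact ⟨a, hs ha, b, hs hb, hab⟩
  · rw [← heq] at hs hfh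
    have h2 := hI.card_le_hilbertFn hs
    split_ifs with hd2
    · subst hd2
      -- Here `j + i = 2` with `i` and `j` positive; as the squares of the variables lie in `I`, the
      -- form `f` is squarefree.
      obtain rfl : i = 1 := by omega
      refine le_trans (four_le_card_support_of_squarefree hfh h0 ?_ hL) h2
      intro a ha k
      have := apply_lt_of_mem_standardExponents hsingle (hs ha) k
      omega
    · omega

end LowerBound

/-! ### Ideals omitting the monomials of a given form -/

section Sharpness

variable {n : ℕ} {𝕜 : Type*} [Field 𝕜] {d : ℕ}

theorem finite_gradedPiece (I : Ideal (MvPolynomial (Fin n) 𝕜)) (j : ℕ) :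
    Module.Finite 𝕜 (gradedPiece I j) :=
  Module.Finite.iff_fg.2 ((homogeneousSubmodule_fg (Fin n) 𝕜 j).map _)

/-- An injective map into a space of no larger finite dimension would be surjective. -/
theorem not_mulPowHasMaximalRank_of_hilbertFn_le {I : Ideal (MvPolynomial (Fin n) 𝕜)}
    {l : MvPolynomial (Fin n) 𝕜} (hl : l.IsHomogeneous 1) {i j : ℕ}
    (hs : ¬ MulPowSurjective I l i j) (h : hilbertFn I (j + i) ≤ hilbertFn I j) :
    ¬ MulPowHasMaximalRank I l i j := by
  rintro (hinj | hsurj)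
  · apply hs
    have := finite_gradedPiece I (j + i)
    have hle : (gradedPiece I j).map (mulPow I l i) ≤ gradedPiece I (j + i) :=
      Submodule.map_le_iff_le_comap.2 (mulPow_mapsTo I hl i j)
    have hrank : Module.finrank 𝕜 ((gradedPiece I j).map (mulPow I l i)) = hilbertFn I j := by
      rw [← LinearMap.range_domRestrict]
      exact LinearMap.finrank_range_of_inj (Set.injOn_iff_injective.1 hinj)
    have heq := Submodule.eq_of_le_of_finrank_le hle (by rw [hrank]; exact h)
    exact heq.ge
  · exact hs hsurj

theorem isMonomialIdealGeneratedInDegree_offSupportIdeal (d : ℕ) (f : MvPolynomial (Fin n) 𝕜) :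
    IsMonomialIdealGeneratedInDegree (offSupportIdeal d f) d :=
  ⟨_, fun _ h => h.1, rfl⟩

theorem standardExponents_offSupportIdeal {f : MvPolynomial (Fin n) 𝕜}
    (hf : f.IsHomogeneous d) : standardExponents (offSupportIdeal d f) d = f.support := by
  classical
  ext a
  simp only [standardExponents, offSupportIdeal, mem_ideal_span_monomial_image,
    support_monomial, one_ne_zero, if_false, Finset.mem_singleton, forall_eq, Set.mem_ofPred_eq,
    SetLike.mem_coe]
  constructor
  · rintro ⟨had, ha⟩
    by_contra h
    exact ha ⟨a, ⟨had, h⟩, le_rfl⟩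
  · intro ha
    have had : a.degree = d := by
      by_contra h
      exact mem_support_iff.1 ha (hf.coeff_eq_zero h)
    refine ⟨had, ?_⟩
    rintro ⟨b, ⟨hbd, hb⟩, hba⟩
    obtain ⟨t, rfl⟩ := exists_add_of_le hba
    rw [map_add, hbd, Nat.add_eq_left, Finsupp.degree_eq_zero_iff] at had
    rw [had, add_zero] at ha
    exact hb ha

theorem hilbertFn_offSupportIdeal {f : MvPolynomial (Fin n) 𝕜} (hf : f.IsHomogeneous d) :
    hilbertFn (offSupportIdeal d f) d = f.support.card := by
  rw [(isMonomialIdealGeneratedInDegree_offSupportIdeal d f).hilbertFn_eq_ncard,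
    standardExponents_offSupportIdeal hf, Set.ncard_coe_finset]

theorem isArtinianRing_offSupportIdeal {f : MvPolynomial (Fin n) 𝕜}
    (hf : ∀ k, Finsupp.single k d ∉ f.support) :
    IsArtinianRing (MvPolynomial (Fin n) 𝕜 ⧸ offSupportIdeal d f) :=
  isArtinianRing_of_single_mem d fun k =>
    Ideal.subset_span ⟨_, ⟨Finsupp.degree_single _ _, hf k⟩, rfl⟩

theorem mem_standardExponents_offSupportIdeal_of_lt (f : MvPolynomial (Fin n) 𝕜)
    {a : Fin n →₀ ℕ} {j : ℕ} (ha : a.degree = j) (hj : j < d) :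
    a ∈ standardExponents (offSupportIdeal d f) j := by
  refine ⟨ha, fun h => ?_⟩
  obtain ⟨b, hba, hbd, -⟩ :=
    ((isMonomialIdealGeneratedInDegree_offSupportIdeal d f).monomial_mem_iff a).1 h
  have := Finsupp.degree_mono hba
  omega

/-- The killed form `g` may differ from the form `f` that defines the ideal. This freedom lets one
ideal work against every linear form. -/
theorem not_mulPowSurjective_offSupportIdeal [CharZero 𝕜] {f g : MvPolynomial (Fin n) 𝕜}
    {i j : ℕ} {c : Fin n → 𝕜} (hf : f.IsHomogeneous (j + i)) (h0 : g ≠ 0)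
    (hs : g.support ⊆ f.support) (hL : (dirDeriv c)^[i] g = 0) :
    ¬ MulPowSurjective (offSupportIdeal (j + i) f) (linearForm c) i j := by
  refine (isMonomialIdealGeneratedInDegree_offSupportIdeal _ f).not_mulPowSurjective h0 ?_ hL
  rw [standardExponents_offSupportIdeal hf]
  exact_mod_cast hs

/-- In each direction there is a non-zero constant linear form in two given variables. -/
theorem exists_binomial_dirDeriv_eq_zero (c : Fin n → 𝕜) {x y : Fin n} (hxy : x ≠ y) :
    ∃ u v : 𝕜, C u * X x - C v * X y ≠ (0 : MvPolynomial (Fin n) 𝕜) ∧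
      dirDeriv c (C u * X x - C v * X y) = 0 := by
  have hne : ∀ u v : 𝕜, u ≠ 0 ∨ v ≠ 0 → C u * X x - C v * X y ≠ (0 : MvPolynomial (Fin n) 𝕜) := by
    intro u v huv h
    have h1 := congrArg (eval (Pi.single x (1 : 𝕜))) h
    have h2 := congrArg (eval (Pi.single y (1 : 𝕜))) h
    simp [hxy, hxy.symm] at h1 h2
    tauto
  have hD : ∀ u v : 𝕜, dirDeriv c (C u * X x - C v * X y) = C (u * c x - v * c y) := by
    intro u v
    rw [map_sub, Derivation.leibniz, Derivation.leibniz, dirDeriv_X, dirDeriv_X]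
    simp
  -- The natural choice `u = c y`, `v = c x` gives the zero form precisely when both vanish, and
  -- then `X x` itself is killed.
  by_cases h : c y = 0 ∧ c x = 0
  · exact ⟨1, 0, hne _ _ (Or.inl one_ne_zero), by rw [hD]; simp [h.2]⟩
  · exact ⟨c y, c x, hne _ _ (not_and_or.1 h), by rw [hD, mul_comm, sub_self, C_0]⟩

/-! ### The forms `x^p (y-z)^m` -/

variable {x y z : Fin n}

/-- The exponent of `x^p y^k z^(m-k)`. -/
noncomputable def trinomialExponent (x y z : Fin n) (p m k : ℕ) : Fin n →₀ ℕ :=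
  Finsupp.single x p + Finsupp.single y k + Finsupp.single z (m - k)

theorem degree_trinomialExponent (x y z : Fin n) {p m k : ℕ} (hk : k ≤ m) :
    (trinomialExponent x y z p m k).degree = p + m := by
  simp only [trinomialExponent, map_add, Finsupp.degree_single]
  omega

theorem trinomialExponent_injective (hxy : x ≠ y) (hyz : y ≠ z) (p m : ℕ) :
    Function.Injective (trinomialExponent x y z p m) := by
  intro k t h
  have := DFunLike.congr_fun h y
  simpa [trinomialExponent, hxy, hyz.symm] using this

theorem X_pow_mul_binomial_pow (x y z : Fin n) (p m : ℕ) (u v : 𝕜) :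
    (X x ^ p * (C u * X y - C v * X z) ^ m : MvPolynomial (Fin n) 𝕜) =
      ∑ k ∈ Finset.range (m + 1), monomial (trinomialExponent x y z p m k)
        (u ^ k * (-v) ^ (m - k) * m.choose k) := by
  rw [sub_eq_add_neg, add_pow, Finset.mul_sum]
  refine Finset.sum_congr rfl fun k _ => ?_
  rw [← neg_mul, ← C_neg, mul_pow, mul_pow, trinomialExponent, ← C_pow, ← C_pow,
    ← C_eq_coe_nat, X_pow_eq_monomial, X_pow_eq_monomial, X_pow_eq_monomial,
    C_mul_monomial, C_mul_monomial, monomial_mul, mul_comm _ (C _), C_mul_monomial, monomial_mul]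
  congr 1
  · rw [add_assoc]
  · ring

theorem support_X_pow_mul_binomial_pow_subset (x y z : Fin n) (p m : ℕ) (u v : 𝕜) :
    (X x ^ p * (C u * X y - C v * X z) ^ m : MvPolynomial (Fin n) 𝕜).support ⊆
      (Finset.range (m + 1)).image (trinomialExponent x y z p m) := by
  classical
  rw [X_pow_mul_binomial_pow]
  refine support_sum.trans (Finset.biUnion_subset.2 fun k hk => ?_)
  refine support_monomial_subset.trans (Finset.singleton_subset_iff.2 ?_)
  exact Finset.mem_image_of_mem _ hk

theorem support_X_pow_mul_sub_pow [CharZero 𝕜] (hxy : x ≠ y) (hyz : y ≠ z) (p m : ℕ) :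
    (X x ^ p * (X y - X z) ^ m : MvPolynomial (Fin n) 𝕜).support =
      (Finset.range (m + 1)).image (trinomialExponent x y z p m) := by
  classical
  have h1 : (X x ^ p * (X y - X z) ^ m : MvPolynomial (Fin n) 𝕜) =
      X x ^ p * (C 1 * X y - C 1 * X z) ^ m := by simp
  rw [h1]
  refine (support_X_pow_mul_binomial_pow_subset x y z p m 1 1).antisymm fun a ha => ?_
  obtain ⟨k, hk, rfl⟩ := Finset.mem_image.1 ha
  rw [X_pow_mul_binomial_pow, mem_support_iff, coeff_sum]
  simp only [coeff_monomial, (trinomialExponent_injective hxy hyz p m).eq_iff,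
    Finset.sum_ite_eq', if_pos hk]
  have : m.choose k ≠ 0 := (Nat.choose_pos (by simpa [Nat.lt_succ_iff] using hk)).ne'
  simp [this]

theorem card_support_X_pow_mul_sub_pow [CharZero 𝕜] (hxy : x ≠ y) (hyz : y ≠ z) (p m : ℕ) :
    (X x ^ p * (X y - X z) ^ m : MvPolynomial (Fin n) 𝕜).support.card = m + 1 := by
  rw [support_X_pow_mul_sub_pow hxy hyz,
    Finset.card_image_of_injective _ (trinomialExponent_injective hxy hyz p m),
    Finset.card_range]

theorem isHomogeneous_X_pow_mul_sub_pow (x y z : Fin n) (p m : ℕ) :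
    (X x ^ p * (X y - X z) ^ m : MvPolynomial (Fin n) 𝕜).IsHomogeneous (p + m) := by
  have := (isHomogeneous_X_pow (R := 𝕜) x p).mul
    (((isHomogeneous_X 𝕜 y).sub (isHomogeneous_X 𝕜 z)).pow m)
  rwa [one_mul] at this

theorem isArtinianRing_offSupportIdeal_X_pow_mul_sub_pow [CharZero 𝕜] (hxy : x ≠ y)
    (hxz : x ≠ z) (hyz : y ≠ z) {p m : ℕ} (hp : p ≠ 0) (hm : m ≠ 0) :
    IsArtinianRing (MvPolynomial (Fin n) 𝕜 ⧸
      offSupportIdeal (p + m) (X x ^ p * (X y - X z) ^ m : MvPolynomial (Fin n) 𝕜)) := by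
  refine isArtinianRing_offSupportIdeal fun k hk => ?_
  rw [support_X_pow_mul_sub_pow hxy hyz] at hk
  obtain ⟨t, -, ht⟩ := Finset.mem_image.1 hk
  have := DFunLike.congr_fun ht x
  simp only [trinomialExponent, Finsupp.add_apply, Finsupp.single_apply, if_pos,
    if_neg hxy.symm, if_neg hxz.symm] at this
  -- The exponent of `x` is `p` in every term, but `0` or `p + m` in a pure power.
  split_ifs at this <;> omega

/-- For the ideal of the monomials not in `x^p (y-z)^(j+1)`, no linear form `l` makes
`l^(p+1) : R_j → R_{j+p+1}` surjective. -/
theorem not_mulPowSurjective_X_pow_mul_sub_pow [CharZero 𝕜] (hxy : x ≠ y) (hyz : y ≠ z)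
    {p j : ℕ} {l : MvPolynomial (Fin n) 𝕜} (hl : l.IsHomogeneous 1) :
    ¬ MulPowSurjective (offSupportIdeal (j + (p + 1))
      (X x ^ p * (X y - X z) ^ (j + 1) : MvPolynomial (Fin n) 𝕜)) l (p + 1) j := by
  obtain ⟨c, rfl⟩ := exists_eq_linearForm hl
  obtain ⟨u, v, hne, hD⟩ := exists_binomial_dirDeriv_eq_zero c hyz
  refine not_mulPowSurjective_offSupportIdeal
    (g := X x ^ p * (C u * X y - C v * X z) ^ (j + 1)) ?_
    (mul_ne_zero (pow_ne_zero _ (X_ne_zero x)) (pow_ne_zero _ hne)) ?_ ?_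
  · rw [show j + (p + 1) = p + (j + 1) by ring]
    exact isHomogeneous_X_pow_mul_sub_pow x y z p (j + 1)
  · rw [support_X_pow_mul_sub_pow hxy hyz]
    exact support_X_pow_mul_binomial_pow_subset x y z p (j + 1) u v
  -- The binomial is a constant for the derivation, so only `x^p` is differentiated, and `p + 1`
  -- derivatives kill it.
  · rw [iterate_dirDeriv_mul_of_eq_zero, iterate_dirDeriv_eq_zero c (isHomogeneous_X_pow x p),
      zero_mul]
    rw [Derivation.leibniz_pow, hD]
    simp

theorem not_mulPowHasMaximalRank_X_pow_mul_sub_pow [CharZero 𝕜] (hxy : x ≠ y) (hxz : x ≠ z)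
    (hyz : y ≠ z) {p j : ℕ} (hj : j ≠ 0) {l : MvPolynomial (Fin n) 𝕜} (hl : l.IsHomogeneous 1) :
    ¬ MulPowHasMaximalRank (offSupportIdeal (j + (p + 1))
      (X x ^ p * (X y - X z) ^ (j + 1) : MvPolynomial (Fin n) 𝕜)) l (p + 1) j := by
  classical
  refine not_mulPowHasMaximalRank_of_hilbertFn_le hl
    (not_mulPowSurjective_X_pow_mul_sub_pow hxy hyz hl) ?_
  have hhom := isHomogeneous_X_pow_mul_sub_pow (𝕜 := 𝕜) x y z p (j + 1)
  rw [show p + (j + 1) = j + (p + 1) by ring] at hhom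
  rw [hilbertFn_offSupportIdeal hhom, card_support_X_pow_mul_sub_pow hxy hyz]
  -- The target has dimension `j + 2`. In degree `j`, below the degree of the generators, `x^j` and
  -- the `j + 1` monomials in `y`, `z` already give as many.
  have hnot : Finsupp.single x j ∉
      (Finset.range (j + 1)).image (trinomialExponent x y z 0 j) := by
    intro h
    obtain ⟨t, -, ht⟩ := Finset.mem_image.1 h
    have := DFunLike.congr_fun ht x
    simp [trinomialExponent, hxy.symm, hxz.symm] at this
    exact hj this.symm
  have hcard := Finset.card_insert_of_notMem hnot
  rw [Finset.card_image_of_injective _ (trinomialExponent_injective hxy hyz 0 j),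
    Finset.card_range] at hcard
  rw [← hcard]
  refine (isMonomialIdealGeneratedInDegree_offSupportIdeal _ _).card_le_hilbertFn ?_
  intro a ha
  refine mem_standardExponents_offSupportIdeal_of_lt _ ?_ (by omega)
  rw [Finset.mem_coe, Finset.mem_insert] at ha
  rcases ha with rfl | ha
  · exact Finsupp.degree_single _ _
  · obtain ⟨t, ht, rfl⟩ := Finset.mem_image.1 ha
    rw [degree_trinomialExponent x y z (by simpa [Nat.lt_succ_iff] using ht), zero_add]

/-! ### The quadratic case: the monomials of `(x-y)(z-w)` -/

variable {w : Fin n}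

/-- The exponents of the monomials `xz`, `xw`, `yz`, `yw`. -/
noncomputable def fourCycleExponents (x y z w : Fin n) : Finset (Fin n →₀ ℕ) :=
  {Finsupp.single x 1 + Finsupp.single z 1, Finsupp.single x 1 + Finsupp.single w 1,
    Finsupp.single y 1 + Finsupp.single z 1, Finsupp.single y 1 + Finsupp.single w 1}

theorem binomial_mul_binomial (x y z w : Fin n) (u v s t : 𝕜) :
    ((C u * X x - C v * X y) * (C s * X z - C t * X w) : MvPolynomial (Fin n) 𝕜) =
      monomial (Finsupp.single x 1 + Finsupp.single z 1) (u * s) +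
      (monomial (Finsupp.single x 1 + Finsupp.single w 1) (-(u * t)) +
      (monomial (Finsupp.single y 1 + Finsupp.single z 1) (-(v * s)) +
      monomial (Finsupp.single y 1 + Finsupp.single w 1) (v * t))) := by
  have h : ∀ (a b : Fin n) (r q : 𝕜), monomial (Finsupp.single a 1 + Finsupp.single b 1) (r * q) =
      C r * X a * (C q * X b) := by
    intro a b r q
    rw [C_mul_X_eq_monomial, C_mul_X_eq_monomial, monomial_mul]
  rw [map_neg, map_neg, h, h, h, h]
  ring

theorem support_binomial_mul_binomial_subset (x y z w : Fin n) (u v s t : 𝕜) :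
    ((C u * X x - C v * X y) * (C s * X z - C t * X w) : MvPolynomial (Fin n) 𝕜).support ⊆
      fourCycleExponents x y z w := by
  classical
  intro a ha
  rw [mem_support_iff, binomial_mul_binomial] at ha
  by_contra h
  simp only [fourCycleExponents, Finset.mem_insert, Finset.mem_singleton, not_or] at h
  apply ha
  simp [coeff_monomial, Ne.symm h.1, Ne.symm h.2.1, Ne.symm h.2.2.1, Ne.symm h.2.2.2]

theorem single_add_single_inj {a b c e : Fin n} :
    (Finsupp.single a 1 + Finsupp.single b 1 : Fin n →₀ ℕ) =
      Finsupp.single c 1 + Finsupp.single e 1 ↔ (a = c ∧ b = e) ∨ (a = e ∧ b = c) := by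
  rw [Finsupp.single_add_single_eq_single_add_single one_ne_zero one_ne_zero]
  simp

theorem card_fourCycleExponents (hxy : x ≠ y) (hxz : x ≠ z) (hxw : x ≠ w) (hyz : y ≠ z)
    (hzw : z ≠ w) : (fourCycleExponents x y z w).card = 4 := by
  rw [fourCycleExponents, Finset.card_insert_of_notMem, Finset.card_insert_of_notMem,
    Finset.card_insert_of_notMem, Finset.card_singleton] <;>
  simp only [Finset.mem_insert, Finset.mem_singleton, single_add_single_inj] <;> grind

/-- The sum of the monomials `xz`, `xw`, `yz`, `yw`. -/
noncomputable def fourCycleForm (𝕜 : Type*) [Field 𝕜] (x y z w : Fin n) :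
    MvPolynomial (Fin n) 𝕜 :=
  ∑ a ∈ fourCycleExponents x y z w, monomial a 1

theorem support_fourCycleForm (x y z w : Fin n) :
    (fourCycleForm 𝕜 x y z w).support = fourCycleExponents x y z w := by
  classical
  ext a
  simp [fourCycleForm, coeff_sum, coeff_monomial]

theorem isHomogeneous_fourCycleForm (x y z w : Fin n) :
    (fourCycleForm 𝕜 x y z w).IsHomogeneous 2 := by
  refine IsHomogeneous.sum _ _ _ fun a ha => isHomogeneous_monomial _ ?_
  simp only [fourCycleExponents, Finset.mem_insert, Finset.mem_singleton] at ha
  rcases ha with rfl | rfl | rfl | rfl <;> simp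

theorem isArtinianRing_fourCycleForm (hxz : x ≠ z) (hxw : x ≠ w) (hyz : y ≠ z) (hyw : y ≠ w) :
    IsArtinianRing (MvPolynomial (Fin n) 𝕜 ⧸ offSupportIdeal 2 (fourCycleForm 𝕜 x y z w)) := by
  refine isArtinianRing_offSupportIdeal fun k hk => ?_
  rw [support_fourCycleForm, show (2 : ℕ) = 1 + 1 from rfl, Finsupp.single_add] at hk
  simp only [fourCycleExponents, Finset.mem_insert, Finset.mem_singleton,
    single_add_single_inj] at hk
  rcases hk with (h | h) | (h | h) | (h | h) | (h | h) <;>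
    exact absurd (h.1.symm.trans h.2)
      (by simp [hxz, hxw, hyz, hyw, hxz.symm, hxw.symm, hyz.symm, hyw.symm])

/-- For each direction, a constant linear form in `x`, `y` times one in `z`, `w` is killed, and it
involves only the four monomials. -/
theorem not_mulPowSurjective_fourCycleForm [CharZero 𝕜] (hxy : x ≠ y) (hzw : z ≠ w)
    {l : MvPolynomial (Fin n) 𝕜} (hl : l.IsHomogeneous 1) :
    ¬ MulPowSurjective (offSupportIdeal 2 (fourCycleForm 𝕜 x y z w)) l 1 1 := by
  obtain ⟨c, rfl⟩ := exists_eq_linearForm hl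
  obtain ⟨u, v, hne, hD⟩ := exists_binomial_dirDeriv_eq_zero c hxy
  obtain ⟨s, t, hne', hD'⟩ := exists_binomial_dirDeriv_eq_zero c hzw
  refine not_mulPowSurjective_offSupportIdeal (j := 1) (i := 1)
    (isHomogeneous_fourCycleForm x y z w) (mul_ne_zero hne hne') ?_ ?_
  · rw [support_fourCycleForm]
    exact support_binomial_mul_binomial_subset x y z w u v s t
  · rw [Function.iterate_one, Derivation.leibniz, hD, hD', smul_zero, smul_zero, add_zero]

theorem hilbertFn_fourCycleForm (hxy : x ≠ y) (hxz : x ≠ z) (hxw : x ≠ w) (hyz : y ≠ z)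
    (hzw : z ≠ w) :
    hilbertFn (offSupportIdeal 2 (fourCycleForm 𝕜 x y z w)) 2 = 4 := by
  rw [hilbertFn_offSupportIdeal (isHomogeneous_fourCycleForm x y z w), support_fourCycleForm,
    card_fourCycleExponents hxy hxz hxw hyz hzw]

/-- The variables are independent in `R_1`, so its dimension is at least `n ≥ 4`, the dimension of
`R_2`. -/
theorem not_mulPowHasMaximalRank_fourCycleForm [CharZero 𝕜] (hn : 4 ≤ n) (hxy : x ≠ y)
    (hxz : x ≠ z) (hxw : x ≠ w) (hyz : y ≠ z) (hzw : z ≠ w)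
    {l : MvPolynomial (Fin n) 𝕜} (hl : l.IsHomogeneous 1) :
    ¬ MulPowHasMaximalRank (offSupportIdeal 2 (fourCycleForm 𝕜 x y z w)) l 1 1 := by
  classical
  refine not_mulPowHasMaximalRank_of_hilbertFn_le hl
    (not_mulPowSurjective_fourCycleForm hxy hzw hl) ?_
  rw [hilbertFn_fourCycleForm hxy hxz hxw hyz hzw]
  have hcard : (Finset.univ.image fun k : Fin n => Finsupp.single k 1).card = n := by
    rw [Finset.card_image_of_injective _ (Finsupp.single_left_injective one_ne_zero),
      Finset.card_univ, Fintype.card_fin]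
  refine hn.trans (hcard.ge.trans
    ((isMonomialIdealGeneratedInDegree_offSupportIdeal _ _).card_le_hilbertFn ?_))
  intro a ha
  obtain ⟨k, -, rfl⟩ := Finset.mem_image.1 (Finset.mem_coe.1 ha)
  exact mem_standardExponents_offSupportIdeal_of_lt _ (Finsupp.degree_single _ _) one_lt_two

theorem isHomogeneous_sumVars (n : ℕ) (𝕜 : Type*) [Field 𝕜] : (sumVars n 𝕜).IsHomogeneous 1 := by
  rw [sumVars_eq_linearForm]
  exact isHomogeneous_linearForm 1

end Sharpness

/-! ### Assembly of the bounds and the examples -/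

theorem theorem2 (n : ℕ) (hn : 3 ≤ n) (𝕜 : Type*) [Field 𝕜] [CharZero 𝕜]
    (d : ℕ) (hd : 2 ≤ d) :
    -- (i), the bound
    (∀ I : Ideal (MvPolynomial (Fin n) 𝕜),
      IsMonomialIdealGeneratedInDegree I d → IsArtinianRing (MvPolynomial (Fin n) 𝕜 ⧸ I) →
      ¬ HasSLP I → (if d = 2 then 4 else 3) ≤ hilbertFn I d) ∧
    -- (i), sharpness (for `n = 3`, `d = 2` no quotient fails the SLP)
    ((d = 2 → 4 ≤ n) →
      ∃ I : Ideal (MvPolynomial (Fin n) 𝕜),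
        IsMonomialIdealGeneratedInDegree I d ∧ IsArtinianRing (MvPolynomial (Fin n) 𝕜 ⧸ I) ∧
        ¬ HasSLP I ∧ ¬ MulPowSurjective I (sumVars n 𝕜) (d - 1) 1 ∧
        hilbertFn I d = if d = 2 then 4 else 3) ∧
    -- (ii), the bound
    (∀ i : ℕ, 1 ≤ i → i ≤ d - 1 → ∀ I : Ideal (MvPolynomial (Fin n) 𝕜),
      IsMonomialIdealGeneratedInDegree I d → IsArtinianRing (MvPolynomial (Fin n) 𝕜 ⧸ I) →
      (∃ j : ℕ, ¬ MulPowHasMaximalRank I (sumVars n 𝕜) i j) →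
      d - i + 2 ≤ hilbertFn I d) ∧
    -- (ii), sharpness
    (∀ i : ℕ, 2 ≤ i → i ≤ d - 1 → ∃ I : Ideal (MvPolynomial (Fin n) 𝕜),
      I = offSupportIdeal d
        (X ⟨0, by omega⟩ ^ (i - 1) * (X ⟨1, by omega⟩ - X ⟨2, by omega⟩) ^ (d - i + 1)) ∧
      IsMonomialIdealGeneratedInDegree I d ∧ IsArtinianRing (MvPolynomial (Fin n) 𝕜 ⧸ I) ∧
      ¬ MulPowSurjective I (sumVars n 𝕜) i (d - i) ∧
      ¬ MulPowHasMaximalRank I (sumVars n 𝕜) i (d - i) ∧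
      hilbertFn I d = d - i + 2) := by
  have hn0 : 0 < n := by omega
  have h01 : (⟨0, by omega⟩ : Fin n) ≠ ⟨1, by omega⟩ := by simp
  have h02 : (⟨0, by omega⟩ : Fin n) ≠ ⟨2, by omega⟩ := by simp
  have h12 : (⟨1, by omega⟩ : Fin n) ≠ ⟨2, by omega⟩ := by simp
  refine ⟨fun I hI hA h => hI.le_hilbertFn_of_not_hasSLP hn0 hd hA h, fun hd4 => ?_,
    fun i hi hid I hI hA ⟨j, hj⟩ => ?_, fun i hi hid => ?_⟩
  · by_cases hd2 : d = 2
    · subst hd2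
      have hn4 := hd4 rfl
      have h03 : (⟨0, by omega⟩ : Fin n) ≠ ⟨3, by omega⟩ := by simp
      have h13 : (⟨1, by omega⟩ : Fin n) ≠ ⟨3, by omega⟩ := by simp
      have h23 : (⟨2, by omega⟩ : Fin n) ≠ ⟨3, by omega⟩ := by simp
      refine ⟨_, isMonomialIdealGeneratedInDegree_offSupportIdeal 2 (fourCycleForm 𝕜 _ _ _ _),
        isArtinianRing_fourCycleForm h02 h03 h12 h13, ?_,
        not_mulPowSurjective_fourCycleForm h01 h23 (isHomogeneous_sumVars n 𝕜),
        hilbertFn_fourCycleForm h01 h02 h03 h12 h23⟩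
      rintro ⟨l, hl, h⟩
      exact not_mulPowHasMaximalRank_fourCycleForm hn4 h01 h02 h03 h12 h23 hl (h 1 le_rfl 1)
    -- The case `j = 1`, `i = d - 1`: the form `x^(d-2) (y-z)^2` has three terms.
    · obtain ⟨p, rfl⟩ : ∃ p, d = 1 + (p + 1) := ⟨d - 2, by omega⟩
      have hpd : 1 + (p + 1) = p + (1 + 1) := by ring
      refine ⟨_, isMonomialIdealGeneratedInDegree_offSupportIdeal _
        (X ⟨0, by omega⟩ ^ p * (X ⟨1, by omega⟩ - X ⟨2, by omega⟩) ^ (1 + 1)), ?_, ?_, ?_, ?_⟩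
      · rw [hpd]
        exact isArtinianRing_offSupportIdeal_X_pow_mul_sub_pow h01 h02 h12 (by omega) (by omega)
      · rintro ⟨l, hl, h⟩
        exact not_mulPowHasMaximalRank_X_pow_mul_sub_pow h01 h02 h12 one_ne_zero hl
          (h (p + 1) (by omega) 1)
      · rw [show 1 + (p + 1) - 1 = p + 1 by omega]
        exact not_mulPowSurjective_X_pow_mul_sub_pow h01 h12 (isHomogeneous_sumVars n 𝕜)
      · rw [if_neg hd2, hpd, hilbertFn_offSupportIdeal (isHomogeneous_X_pow_mul_sub_pow _ _ _ _ _),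
          card_support_X_pow_mul_sub_pow h01 h12]
  · have := hI.le_hilbertFn_of_not_hasMaximalRank hn0 hj
    omega
  · obtain ⟨p, rfl⟩ : ∃ p, i = p + 1 := ⟨i - 1, by omega⟩
    obtain ⟨j, rfl⟩ : ∃ j, d = j + (p + 1) := ⟨d - (p + 1), by omega⟩
    have hpd : j + (p + 1) = p + (j + 1) := by ring
    refine ⟨_, rfl, isMonomialIdealGeneratedInDegree_offSupportIdeal _ _, ?_⟩
    rw [Nat.add_sub_cancel, Nat.add_sub_cancel]
    refine ⟨?_, not_mulPowSurjective_X_pow_mul_sub_pow h01 h12 (isHomogeneous_sumVars n 𝕜),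
      not_mulPowHasMaximalRank_X_pow_mul_sub_pow h01 h02 h12 (by omega)
        (isHomogeneous_sumVars n 𝕜), ?_⟩
    · rw [hpd]
      exact isArtinianRing_offSupportIdeal_X_pow_mul_sub_pow h01 h02 h12 (by omega) (by omega)
    · rw [hpd, hilbertFn_offSupportIdeal (isHomogeneous_X_pow_mul_sub_pow _ _ _ _ _),
        card_support_X_pow_mul_sub_pow h01 h12]
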